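/- **Setting.** Let $\mathcal S$ be a finite set of shocks with transition probabilities $\pi(s'|s)>0$, $\sum_{s'}\pi(s'|s)=1$; let $\mathcal A$ be a finite set of actions, $\mathcal X$ a countable set of states, $\zeta:\mathcal X\times\mathcal A\times\mathcal S\to\mathcal X$, $p:\mathcal X\times\mathcal A\times\mathcal S\to\mathbb R$, let $r,\,g^i,\,\bar g^i:\mathcal X\times\mathcal A\times\mathcal S\to\mathbb R$ $(i=1,\dots,I)$ be bounded (for instance, $\bar g^i$ constant), and $0<\beta<1$. A shock history is $s^t=(s_0,\dots,s_t)\in\mathcal S^{t+1}$; a plan is a family $a=(a(s^t))_{t\ge 0,\,s^t}$ of elements of $\mathcal A$. From $x_0\in\mathcal X$ it generates states $x(s^0)=x_0$, $x(s^{t+1})=\zeta(x(s^t),a(s^t),s_t)$. Let $\tilde{\mathcal A}^\infty(x_0)$ be the set of plans with $p(x(s^t),a(s^t),s_t)\ge 0$ for all $t$ and $s^t$. Write $\mathbb E_{s_t}$ for the expectation over future shocks given $s_t$, and $$G^i_{s^t}(a)=\mathbb E_{s_t}\sum_{n=0}^\infty\beta^n g^i\big(x(s^{t+n}),a(s^{t+n}),s_{t+n}\big)-\bar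 g^i\big(x(s^t),a(s^t),s_t\big).$$ Assume that for every $x_0\in\mathcal X$ there is $a\in\tilde{\mathcal A}^\infty(x_0)$ with $G^i_{s^t}(a)\ge 0$ for all $i$, $t$, $s^t$. Fix $\gamma\in\mathbb R_+^I$, $x_0\in\mathcal X$, $s_0\in\mathcal S$. A pre-action history is $h^t=(s_0',\tilde a_0,\dots,s_{t-1}',\tilde a_{t-1},s_t')\in\mathcal H^t=\mathcal S^{t+1}\times\mathcal A^t$, and $h^t(a,s^t)=(s_0,a(s^0),\dots,s_{t-1},a(s^{t-1}),s_t)$ is the one generated by a plan $a$ along $s^t$. Put $$F(a)=\mathbb E_{s_0}\sum_{t=0}^\infty\beta^t\Big(r+\sum_{i=1}^I\gamma^i g^i\Big)\big(x(s^t),a(s^t),s_t\big).$$ **Ex-ante lottery problem.** Let $V(\gamma,x_0,s_0)$ be the supremum of $\int F\,dP$ over all probability measures $P$ on $\tilde{\mathcal A}^\infty(x_0)$ (with the product $\sigma$-algebra) such that, for all $i$, $t$ and $h^t\in\mathcal H^t$ with shock component $s^t$, $$\int 1_{\{h^t(a,s^t)=h^t\}}\;G^i_{s^t}(a)\,dP(a)\ge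 0 .$$ **Dual value.** Let $\Lambda$ be the set of families $\lambda^i(h^t)\ge 0$ with $\sum_t\sum_{h^t\in\mathcal H^t}\sum_i\beta^t\lambda^i(h^t)\,\pi^t(s^t|s_0)<\infty$, where $\pi^t(s^t|s_0)$ is the probability of the shock component $s^t$ of $h^t$ for the chain started at $s_0$, and let $$D(\gamma,x_0,s_0)=\inf_{\lambda\in\Lambda}\ \sup_{a\in\tilde{\mathcal A}^\infty(x_0)}\ \mathbb E_{s_0}\sum_{t=0}^\infty\beta^t\Big[\Big(r+\sum_{i=1}^I\gamma^i g^i\Big)\big(x(s^t),a(s^t),s_t\big)+\sum_{i=1}^I\lambda^i\big(h^t(a,s^t)\big)\,G^i_{s^t}(a)\Big].$$ **Theorem.** For all $\gamma\in\mathbb R_+^I$, $x_0\in\mathcal X$, $s_0\in\mathcal S$, the supremum $V(\gamma,x_0,s_0)$ is attained (so the lottery problem has a maximum), and $V(\gamma,x_0,s_0)=D(\gamma,x_0,s_0)$. -/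

import Mathlib

open MeasureTheory

noncomputable section

/-- The data of a dynamic optimization problem with forward-looking constraints: physical states
`X`, actions `A`, exogenous shocks `S`, and forward-looking constraints indexed by `ι`. -/
structure DynamicProblem (X A S ι : Type*) where
  /-- transition probabilities: `trans s s'` is the probability of `s'` tomorrow given `s` today -/
  trans : S → S → ℝ
  /-- discount factor -/
  β : ℝ
  /-- law of motion of the physical state -/
  ζ : X → A → S → X
  /-- the action `a` is feasible at `(x, s)` iff `0 ≤ p x a s` -/
  p : X → A → S → ℝ
  /-- per-period payoff -/
  r : X → A → S → ℝ
  /-- per-period payoffs entering the forward-looking constraints -/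
  g : ι → X → A → S → ℝ
  /-- lower bounds in the forward-looking constraints -/
  gbar : ι → X → A → S → ℝ

/-- An infinite contingent action sequence `(a(s^t))`. The shock history `s^t = (s₀, …, s_t)` is
represented by the list `[s_{t-1}, …, s₀]` of past shocks, most recent first, together with the
current shock `s_t`; thus `t` is the length of the list. -/
abbrev ActionPlan (S A : Type*) : Type _ := List S → S → A

/-- A pre-action history `h^t = (s₀, a₀, …, s_{t-1}, a_{t-1}, s_t)`, represented by the list
`[(s_{t-1}, a_{t-1}), …, (s₀, a₀)]` and the current shock `s_t`. The type collects the histories of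
all lengths `t`. -/
abbrev PreHistory (S A : Type*) : Type _ := List (S × A) × S

/-- Past shocks and actions `[(s_{t-1}, a(s^{t-1})), …, (s₀, a(s^0))]` realized when the plan `a`
is followed along the past shocks `[s_{t-1}, …, s₀]`. -/
def ActionPlan.realized {S A : Type*} (a : ActionPlan S A) : List S → List (S × A)
  | [] => []
  | s :: past => (s, a past s) :: ActionPlan.realized a past

namespace DynamicProblem

variable {X A S ι : Type*}

/-- The physical state `x(s^t)` reached from `x₀` under the plan `a`. It depends on the shocks only
through `[s_{t-1}, …, s₀]`. -/
def state (M : DynamicProblem X A S ι) (x₀ : X) (a : ActionPlan S A) : List S → X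
  | [] => x₀
  | s :: past => M.ζ (M.state x₀ a past) (a past s) s

/-- The set of plans all of whose actions are feasible when the initial state is `x₀`. -/
def feasiblePlans (M : DynamicProblem X A S ι) (x₀ : X) : Set (ActionPlan S A) :=
  {a | ∀ past s, 0 ≤ M.p (M.state x₀ a past) (a past s) s}

/-- `M.expect n φ past s` is the conditional expectation of `φ(s^{t+n})` given the shock history
`s^t = (past, s)`. -/
def expect [Fintype S] (M : DynamicProblem X A S ι) :
    ℕ → (List S → S → ℝ) → List S → S → ℝ
  | 0, φ, past, s => φ past s
  | n + 1, φ, past, s => ∑ s', M.trans s s' * M.expect n φ (s :: past) s'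

open Classical in
/-- `M.shockProb s₀ past s` is the probability of the shock history `s^t = (past, s)` for the
Markov chain started at `s₀`. -/
def shockProb (M : DynamicProblem X A S ι) (s₀ : S) : List S → S → ℝ
  | [], s => if s = s₀ then 1 else 0
  | s' :: past, s => M.shockProb s₀ past s' * M.trans s' s

/-- The continuation value `𝔼_{s_t} ∑_{n ≥ 0} βⁿ gⁱ(x(s^{t+n}), a(s^{t+n}), s_{t+n})` of the plan
`a` after the shock history `s^t = (past, s)`. -/
def continuation [Fintype S] (M : DynamicProblem X A S ι) (x₀ : X) (a : ActionPlan S A) (i : ι)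
    (past : List S) (s : S) : ℝ :=
  ∑' n : ℕ, M.β ^ n *
    M.expect n (fun q σ => M.g i (M.state x₀ a q) (a q σ) σ) past s

/-- Left-hand side minus right-hand side of the `i`-th forward-looking constraint after `s^t`. -/
def slack [Fintype S] (M : DynamicProblem X A S ι) (x₀ : X) (a : ActionPlan S A) (i : ι)
    (past : List S) (s : S) : ℝ :=
  M.continuation x₀ a i past s - M.gbar i (M.state x₀ a past) (a past s) s

/-- Feasibility of a plan for the deterministic (lottery-free) problem with initial state `x₀`:
every action is feasible and every forward-looking constraint holds after every shock history. -/
def IsFeasible [Fintype S] (M : DynamicProblem X A S ι) (x₀ : X) (a : ActionPlan S A) : Prop :=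
  a ∈ M.feasiblePlans x₀ ∧ ∀ i past s, 0 ≤ M.slack x₀ a i past s

/-- The standing assumption (finiteness of `A`, `S`, `ι` and countability of `X` are imposed
separately). -/
structure StandingAssumption [Fintype S] (M : DynamicProblem X A S ι) : Prop where
  trans_pos : ∀ s s', 0 < M.trans s s'
  trans_sum : ∀ s, ∑ s', M.trans s s' = 1
  bounded_r : ∃ C : ℝ, ∀ x a s, |M.r x a s| ≤ C
  bounded_g : ∀ i, ∃ C : ℝ, ∀ x a s, |M.g i x a s| ≤ C
  bounded_gbar : ∀ i, ∃ C : ℝ, ∀ x a s, |M.gbar i x a s| ≤ C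
  β_pos : 0 < M.β
  β_lt_one : M.β < 1
  exists_feasible : ∀ x₀, ∃ a, M.IsFeasible x₀ a

/-- The period payoff `r + ∑ᵢ γⁱ gⁱ` at the shock history `(past, s)` under the plan `a`. -/
def periodPayoff [Fintype ι] (M : DynamicProblem X A S ι) (γ : ι → ℝ) (x₀ : X)
    (a : ActionPlan S A) (past : List S) (s : S) : ℝ :=
  M.r (M.state x₀ a past) (a past s) s
    + ∑ i, γ i * M.g i (M.state x₀ a past) (a past s) s

/-- The planner's objective
`𝔼_{s₀} ∑ₜ βᵗ (r + ∑ᵢ γⁱ gⁱ)(x(s^t), a(s^t), s_t)` at the plan `a`. -/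
def payoff [Fintype S] [Fintype ι] (M : DynamicProblem X A S ι) (γ : ι → ℝ) (x₀ : X) (s₀ : S)
    (a : ActionPlan S A) : ℝ :=
  ∑' t : ℕ, M.β ^ t * M.expect t (M.periodPayoff γ x₀ a) [] s₀

/-- The `ℓ¹` cone `Λ` of multipliers `λⁱ(h^t) ≥ 0` with
`∑ₜ ∑_{h^t} ∑ᵢ βᵗ λⁱ(h^t) πᵗ(s^t | s₀) < ∞`. -/
def multipliers (M : DynamicProblem X A S ι) (s₀ : S) : Set (ι → PreHistory S A → ℝ) :=
  {lam | (∀ i h, 0 ≤ lam i h) ∧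
    Summable fun q : ι × PreHistory S A =>
      M.β ^ q.2.1.length * lam q.1 q.2 * M.shockProb s₀ (q.2.1.map Prod.fst) q.2.2}

/-- The Lagrangian of the deterministic problem; the multipliers are evaluated at the pre-action
histories generated by the plan. -/
def lagrangian [Fintype S] [Fintype ι] (M : DynamicProblem X A S ι) (γ : ι → ℝ) (x₀ : X) (s₀ : S)
    (a : ActionPlan S A) (lam : ι → PreHistory S A → ℝ) : ℝ :=
  ∑' t : ℕ, M.β ^ t *
    M.expect t (fun past s => M.periodPayoff γ x₀ a past s
      + ∑ i, lam i (a.realized past, s) * M.slack x₀ a i past s) [] s₀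

/-- The dual value function `D(γ, x₀, s₀)`. -/
def dualValue [Fintype S] [Fintype ι] (M : DynamicProblem X A S ι) (γ : ι → ℝ) (x₀ : X)
    (s₀ : S) : EReal :=
  ⨅ lam ∈ M.multipliers (A := A) s₀, ⨆ a ∈ M.feasiblePlans x₀,
    (M.lagrangian γ x₀ s₀ a lam : EReal)

/-- Lotteries: probability measures on the set of plans with feasible actions, with respect to the
product `σ`-algebra. -/
abbrev Lottery [MeasurableSpace A] (M : DynamicProblem X A S ι) (x₀ : X) : Type _ :=
  ProbabilityMeasure (M.feasiblePlans x₀)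

/-- The planner's expected objective under a lottery. -/
def lotteryPayoff [Fintype S] [Fintype ι] [MeasurableSpace A] (M : DynamicProblem X A S ι)
    (γ : ι → ℝ) (x₀ : X) (s₀ : S) (P : M.Lottery x₀) : ℝ :=
  ∫ a, M.payoff γ x₀ s₀ (a : ActionPlan S A) ∂(P : Measure (M.feasiblePlans x₀))

/-- The lotteries satisfying the ex-ante forward-looking constraints: for every pre-action history
`h^t` and every `i`, the slack of the `i`-th constraint at `h^t`, multiplied by the indicator of the
event that the past actions drawn by the lottery are those of `h^t`, has non-negative mean. -/
def feasibleLotteries [Fintype S] [MeasurableSpace A] (M : DynamicProblem X A S ι) (x₀ : X) :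
    Set (M.Lottery x₀) :=
  {P | ∀ (i : ι) (h : PreHistory S A),
    0 ≤ ∫ a, Set.indicator
        {b : M.feasiblePlans x₀ | (b : ActionPlan S A).realized (h.1.map Prod.fst) = h.1}
        (fun b => M.slack x₀ (b : ActionPlan S A) i (h.1.map Prod.fst) h.2) a
      ∂(P : Measure (M.feasiblePlans x₀))}

/-- The value `V(γ, x₀, s₀)` of the ex-ante lottery problem. -/
def lotteryValue [Fintype S] [Fintype ι] [MeasurableSpace A] (M : DynamicProblem X A S ι)
    (γ : ι → ℝ) (x₀ : X) (s₀ : S) : EReal :=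
  ⨆ P ∈ M.feasibleLotteries x₀, (M.lotteryPayoff γ x₀ s₀ P : EReal)

end DynamicProblem

end

/-! ### Linear programming over probability measures on a compact space. -/

section Duality

variable {K : Type*} [TopologicalSpace K] [CompactSpace K] [MeasurableSpace K] [BorelSpace K]

/-! The ex-ante problem is a linear program in the lottery. With finitely many actions, feasible
plans form a compact set in the product topology. Period payoffs depend on finitely many
coordinates, and discounting makes the series converge uniformly, so the objective and every
constraint are integrals of continuous functions. The feasible lotteries are then weakly compact and
nonempty, and a maximum exists.

Weak duality: the Lagrangian is the objective plus a summable nonnegative combination of the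
functions `localSlack` (`lagrangian_eq`). Integrating it against a feasible lottery gives at least
the lottery payoff, and some plan attains at least the mean.

Strong duality: let `v` exceed the value. By compactness finitely many constraints already keep the
value below `v`. Hahn-Banach separates the compact convex set of (payoff minus `v`, constraint
means) from the nonnegative orthant. Because `v` is strictly above the value the separation is
strict, so a feasible plan suffices and no Slater condition is needed. Dirac measures turn the
separation into a bound for every plan. The multipliers found are divided by discount times
probability to obtain an element of `multipliers`. Histories of probability zero are handled by
`splice`. -/

theorem integrable_of_continuous_of_compactSpace {f : K → ℝ} (hf : Continuous f) (P : Measure K)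
    [IsFiniteMeasure P] : Integrable f P :=
  (BoundedContinuousFunction.mkOfCompact ⟨f, hf⟩).integrable P

theorem continuous_integral_probabilityMeasure {f : K → ℝ} (hf : Continuous f) :
    Continuous fun P : ProbabilityMeasure K => ∫ a, f a ∂(P : Measure K) :=
  ProbabilityMeasure.continuous_integral_boundedContinuousFunction
    (BoundedContinuousFunction.mkOfCompact ⟨f, hf⟩)

theorem exists_probabilityMeasure_convexComb (P Q : ProbabilityMeasure K) {a b : ℝ} (ha : 0 ≤ a)
    (hb : 0 ≤ b) (hab : a + b = 1) :
    ∃ R : ProbabilityMeasure K, ∀ f : K → ℝ, Continuous f →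
      ∫ x, f x ∂(R : Measure K)
        = a * ∫ x, f x ∂(P : Measure K) + b * ∫ x, f x ∂(Q : Measure K) := by
  refine ⟨⟨ENNReal.ofReal a • (P : Measure K) + ENNReal.ofReal b • (Q : Measure K), ⟨?_⟩⟩, ?_⟩
  · simp [← ENNReal.ofReal_add ha hb, hab]
  · intro f hf
    have hP := integrable_of_continuous_of_compactSpace hf (P : Measure K)
    have hQ := integrable_of_continuous_of_compactSpace hf (Q : Measure K)
    simp only [ProbabilityMeasure.coe_mk]
    rw [integral_add_measure (hP.smul_measure ENNReal.ofReal_ne_top)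
      (hQ.smul_measure ENNReal.ofReal_ne_top), integral_smul_measure, integral_smul_measure,
      ENNReal.toReal_ofReal ha, ENNReal.toReal_ofReal hb, smul_eq_mul, smul_eq_mul]

/-- Lagrange multipliers for a linear program over probability measures on a compact space with
finitely many constraints. -/
theorem exists_finite_multipliers {J : Type*} [Fintype J] [T2Space K] {f : K → ℝ}
    (hf : Continuous f) {c : J → K → ℝ} (hc : ∀ j, Continuous (c j)) {v : ℝ} (a₀ : K)
    (h₀ : ∀ j, 0 ≤ c j a₀)
    (hv : ∀ P : ProbabilityMeasure K, (∀ j, 0 ≤ ∫ a, c j a ∂(P : Measure K)) →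
      ∫ a, f a ∂(P : Measure K) < v) :
    ∃ m : J → ℝ, (∀ j, 0 ≤ m j) ∧ ∀ a, f a + ∑ j, m j * c j a < v := by
  classical
  let Φ : ProbabilityMeasure K → ℝ × (J → ℝ) := fun P =>
    (∫ a, f a ∂(P : Measure K) - v, fun j => ∫ a, c j a ∂(P : Measure K))
  have hΦ : Continuous Φ := ((continuous_integral_probabilityMeasure hf).sub continuous_const).prodMk
    (continuous_pi fun j => continuous_integral_probabilityMeasure (hc j))
  have hconv : Convex ℝ (Set.range Φ) := by
    rintro _ ⟨P, rfl⟩ _ ⟨Q, rfl⟩ a b ha hb hab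
    obtain ⟨R, hR⟩ := exists_probabilityMeasure_convexComb P Q ha hb hab
    refine ⟨R, Prod.ext ?_ (funext fun j => ?_)⟩
    · simp only [Φ, hR f hf, Prod.fst_add, Prod.smul_fst, smul_eq_mul]
      linear_combination v * hab
    · simp [Φ, hR (c j) (hc j)]
  have hdisj : Disjoint (Set.range Φ) (Set.Ici 0) := by
    rw [Set.disjoint_left]
    rintro _ ⟨P, rfl⟩ ⟨h1, h2⟩
    have := hv P fun j => h2 j
    simp only [Φ, Prod.fst_zero] at h1
    linarith
  -- Strict separation: `l < s < t` on the range and `t < l` on the orthant. Since 0 lies in the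
  -- orthant, `t < 0`.
  obtain ⟨l, s, t, hs, hst, ht⟩ := geometric_hahn_banach_compact_closed hconv
    (isCompact_range hΦ) (convex_Ici 0) isClosed_Ici hdisj
  have ht0 : t < 0 := by simpa using ht 0 (by simp)
  have hpos : ∀ u : ℝ × (J → ℝ), 0 ≤ u → 0 ≤ l u := by
    intro u hu
    by_contra! hlu
    -- The orthant is a cone: this multiple of `u` stays in it, yet `l` takes the value `t` there.
    have h1 := ht ((t / l u) • u) (smul_nonneg (div_nonneg_of_nonpos ht0.le hlu.le) hu)
    rw [map_smul, smul_eq_mul, div_mul_cancel₀ _ hlu.ne] at h1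
    exact lt_irrefl _ h1
  set μ₀ := l (1, 0) with hμ₀
  set μ : J → ℝ := fun j => l (0, Pi.single j 1) with hμ
  have hl : ∀ x y, l (x, y) = μ₀ * x + ∑ j, μ j * y j := by
    intro x y
    have : (x, y) = x • ((1 : ℝ), (0 : J → ℝ)) + ∑ j, y j • ((0 : ℝ), (Pi.single j 1 : J → ℝ)) := by
      refine Prod.ext (by simp [Prod.fst_sum]) (funext fun k => ?_)
      simp [Prod.snd_sum, Finset.sum_apply, Pi.single_apply]
    rw [this, map_add, map_sum, map_smul]
    simp only [map_smul, smul_eq_mul, hμ₀, hμ, mul_comm]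
  have hμ0 : ∀ j, 0 ≤ μ j := fun j => hpos _ ⟨le_rfl, Pi.single_nonneg.2 zero_le_one⟩
  have hμ00 : 0 ≤ μ₀ := hpos _ ⟨zero_le_one, le_rfl⟩
  have hdirac : ∀ a, μ₀ * (f a - v) + ∑ j, μ j * c j a < 0 := by
    intro a
    have h1 := hs (Φ ⟨Measure.dirac a, inferInstance⟩) ⟨_, rfl⟩
    simp only [Φ, hl, ProbabilityMeasure.coe_mk,
      integral_dirac' _ _ hf.stronglyMeasurable,
      fun j => integral_dirac' _ a (hc j).stronglyMeasurable] at h1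
    linarith
  -- A vanishing payoff weight would make a nonnegative combination of the constraints at `a₀`
  -- negative.
  have hμpos : 0 < μ₀ := by
    refine hμ00.lt_of_ne fun h => ?_
    have h1 := hdirac a₀
    rw [← h, zero_mul, zero_add] at h1
    exact absurd (Finset.sum_nonneg fun j _ => mul_nonneg (hμ0 j) (h₀ j)) (not_le.2 h1)
  refine ⟨fun j => μ j / μ₀, fun j => div_nonneg (hμ0 j) hμ00, fun a => ?_⟩
  have h1 := hdirac a
  have h2 : ∑ j, μ j / μ₀ * c j a = (∑ j, μ j * c j a) / μ₀ := by
    rw [Finset.sum_div]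
    exact Finset.sum_congr rfl fun j _ => by ring
  have h3 : f a - v + (∑ j, μ j * c j a) / μ₀ < 0 := by
    have : f a - v + (∑ j, μ j * c j a) / μ₀ = (μ₀ * (f a - v) + ∑ j, μ j * c j a) / μ₀ := by
      field_simp
    rw [this]
    exact div_neg_of_neg_of_pos h1 hμpos
  rw [h2]
  linarith

/-- Lagrange multipliers for a linear program over probability measures on a compact space with
arbitrarily many constraints: finitely many multipliers bound the value up to any slack. -/
theorem exists_finsupp_multipliers {J : Type*} [T2Space K] {f : K → ℝ}
    (hf : Continuous f) {c : J → K → ℝ} (hc : ∀ j, Continuous (c j)) {v : ℝ} (a₀ : K)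
    (h₀ : ∀ j, 0 ≤ c j a₀)
    (hv : ∀ P : ProbabilityMeasure K, (∀ j, 0 ≤ ∫ a, c j a ∂(P : Measure K)) →
      ∫ a, f a ∂(P : Measure K) < v) :
    ∃ m : J →₀ ℝ, (∀ j, 0 ≤ m j) ∧ ∀ a, f a + ∑ j ∈ m.support, m j * c j a < v := by
  classical
  have hclosed : ∀ j, IsClosed {P : ProbabilityMeasure K | 0 ≤ ∫ a, c j a ∂(P : Measure K)} :=
    fun j => isClosed_le continuous_const (continuous_integral_probabilityMeasure (hc j))
  have hcomp : IsCompact {P : ProbabilityMeasure K | v ≤ ∫ a, f a ∂(P : Measure K)} :=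
    (isClosed_le continuous_const (continuous_integral_probabilityMeasure hf)).isCompact
  -- The measures with payoff at least `v` form a compact set that the closed constraint sets
  -- jointly miss, so finitely many of them already miss it.
  obtain ⟨s, hs⟩ := hcomp.elim_finite_subfamily_closed _ hclosed (by
    rw [Set.eq_empty_iff_forall_notMem]
    rintro P ⟨h1, h2⟩
    exact absurd (hv P fun j => Set.mem_iInter.1 h2 j) (not_lt.2 h1))
  obtain ⟨m, hm, hmv⟩ := exists_finite_multipliers (J := s) hf (fun j => hc j) a₀ (fun j => h₀ j)
    (v := v) (fun P hP => by
      by_contra! h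
      exact Set.eq_empty_iff_forall_notMem.1 hs P
        ⟨h, Set.mem_iInter₂.2 fun j hj => hP ⟨j, hj⟩⟩)
  let m' : J →₀ ℝ := Finsupp.onFinset s (fun j => if h : j ∈ s then m ⟨j, h⟩ else 0)
    fun j hj => by by_contra h; simp [h] at hj
  have hm' : ∀ j : s, m' j = m j := fun j => by simp [m']
  refine ⟨m', fun j => ?_, fun a => ?_⟩
  · by_cases h : j ∈ s
    · rw [hm' ⟨j, h⟩]; exact hm _
    · simp [m', h]
  · have h1 : ∑ j ∈ m'.support, m' j * c j a = ∑ j : s, m j * c j a := by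
      rw [Finset.sum_subset (Finsupp.support_onFinset_subset : m'.support ⊆ s)
        (fun j _ hj => by rw [Finsupp.notMem_support_iff.1 hj, zero_mul]), ← Finset.sum_coe_sort]
      exact Finset.sum_congr rfl fun j _ => by rw [hm']
    rw [h1]
    exact hmv a

end Duality

namespace DynamicProblem

variable {X A S ι : Type*}

/-! ### Conditional expectations and sums over shock histories. -/

section Expectation

variable [Fintype S] {M : DynamicProblem X A S ι}

theorem abs_expect_le (hM : M.StandingAssumption) {φ : List S → S → ℝ} {C : ℝ}
    (hφ : ∀ q σ, |φ q σ| ≤ C) (n : ℕ) (past : List S) (s : S) : |M.expect n φ past s| ≤ C := by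
  induction n generalizing past s with
  | zero => exact hφ past s
  | succ n ih =>
    calc |∑ s', M.trans s s' * M.expect n φ (s :: past) s'|
        ≤ ∑ s', |M.trans s s' * M.expect n φ (s :: past) s'| := Finset.abs_sum_le_sum_abs _ _
      _ ≤ ∑ s', M.trans s s' * C := Finset.sum_le_sum fun s' _ => by
          rw [abs_mul, abs_of_pos (hM.trans_pos s s')]
          exact mul_le_mul_of_nonneg_left (ih _ _) (hM.trans_pos s s').le
      _ = C := by rw [← Finset.sum_mul, hM.trans_sum, one_mul]

theorem expect_add (φ ψ : List S → S → ℝ) (n : ℕ) (past : List S) (s : S) :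
    M.expect n (fun q σ => φ q σ + ψ q σ) past s = M.expect n φ past s + M.expect n ψ past s := by
  induction n generalizing past s with
  | zero => rfl
  | succ n ih => simp only [expect, ih, mul_add, Finset.sum_add_distrib]

/-- The recursion of `expect` peels off the earliest shock. Peeling off the latest instead matches
the recursion of `shockProb`. -/
theorem expect_succ_eq (φ : List S → S → ℝ) (n : ℕ) (past : List S) (s : S) :
    M.expect (n + 1) φ past s
      = M.expect n (fun q σ => ∑ s', M.trans σ s' * φ (σ :: q) s') past s := by
  induction n generalizing past s with
  | zero => rfl
  | succ n ih =>
    rw [expect, expect]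
    exact Finset.sum_congr rfl fun s' _ => by rw [ih]

theorem continuous_expect {K : Type*} [TopologicalSpace K] {φ : K → List S → S → ℝ}
    (hφ : ∀ q σ, Continuous fun a => φ a q σ) (n : ℕ) (past : List S) (s : S) :
    Continuous fun a => M.expect n (φ a) past s := by
  induction n generalizing past s with
  | zero => exact hφ past s
  | succ n ih => exact continuous_finsetSum _ fun s' _ => continuous_const.mul (ih _ _)

theorem norm_discounted_expect_le (hM : M.StandingAssumption) {φ : List S → S → ℝ} {C : ℝ}
    (hφ : ∀ q σ, |φ q σ| ≤ C) (n : ℕ) (past : List S) (s : S) :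
    ‖M.β ^ n * M.expect n φ past s‖ ≤ M.β ^ n * C := by
  rw [norm_mul, norm_pow, Real.norm_of_nonneg hM.β_pos.le]
  exact mul_le_mul_of_nonneg_left (abs_expect_le hM hφ n past s) (pow_nonneg hM.β_pos.le n)

theorem summable_discount_mul (hM : M.StandingAssumption) (C : ℝ) :
    Summable fun n : ℕ => M.β ^ n * C :=
  (summable_geometric_of_lt_one hM.β_pos.le hM.β_lt_one).mul_right C

theorem continuous_tsum_discounted_expect (hM : M.StandingAssumption) {K : Type*}
    [TopologicalSpace K] {φ : K → List S → S → ℝ} (hφ : ∀ q σ, Continuous fun a => φ a q σ) {C : ℝ}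
    (hC : ∀ a q σ, |φ a q σ| ≤ C) (past : List S) (s : S) :
    Continuous fun a => ∑' n : ℕ, M.β ^ n * M.expect n (φ a) past s :=
  continuous_tsum (fun n => continuous_const.mul (continuous_expect hφ n past s))
    (summable_discount_mul hM C) fun n a => norm_discounted_expect_le hM (hC a) n past s

open Classical in
/-- The shock histories with `n` past shocks. -/
noncomputable def histories : ℕ → Finset (List S × S)
  | 0 => Finset.univ.image fun s => ([], s)
  | n + 1 => (histories n ×ˢ Finset.univ).image fun q => (q.1.2 :: q.1.1, q.2)

theorem mem_histories {n : ℕ} {q : List S × S} : q ∈ histories n ↔ q.1.length = n := by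
  induction n generalizing q with
  | zero =>
    obtain ⟨p, s⟩ := q
    simp [histories, eq_comm]
  | succ n ih =>
    obtain ⟨p, s⟩ := q
    cases p with
    | nil => simp [histories]
    | cons σ p => simp [histories, ih]

theorem expect_eq_sum_histories (s₀ : S) (φ : List S → S → ℝ) (n : ℕ) :
    M.expect n φ [] s₀ = ∑ q ∈ histories n, M.shockProb s₀ q.1 q.2 * φ q.1 q.2 := by
  classical
  induction n generalizing φ with
  | zero =>
    rw [histories, Finset.sum_image fun _ _ _ _ h => (Prod.mk.inj h).2]
    simp [expect, shockProb]
  | succ n ih =>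
    rw [expect_succ_eq, ih, histories, Finset.sum_image, Finset.sum_product]
    · exact Finset.sum_congr rfl fun q _ => by
        rw [Finset.mul_sum]
        exact Finset.sum_congr rfl fun s' _ => (mul_assoc _ _ _).symm
    · rintro ⟨⟨p, σ⟩, s⟩ _ ⟨⟨p', σ'⟩, s'⟩ _ h
      simp only [Prod.mk.injEq, List.cons.injEq] at h ⊢
      exact ⟨⟨h.1.2, h.1.1⟩, h.2⟩

theorem hasSum_sum_histories {f : List S × S → ℝ} {x : ℝ} (hf : HasSum f x) :
    HasSum (fun n => ∑ q ∈ histories n, f q) x := by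
  refine (hf.tsum_fiberwise fun q => q.1.length).congr_fun fun n => ?_
  have h : (fun q : List S × S => q.1.length) ⁻¹' {n} = ↑(histories (S := S) n) := by
    ext q
    simp [mem_histories]
  rw [h, Finset.tsum_subtype']

end Expectation

/-! ### Positivity of history probabilities; `past.getLastD s` is the initial shock, as lists run
from most recent to oldest. -/

section Shocks

variable {M : DynamicProblem X A S ι}

theorem shockProb_pos [Fintype S] (hM : M.StandingAssumption) {s₀ : S} {past : List S} {s : S}
    (h : past.getLastD s = s₀) : 0 < M.shockProb s₀ past s := by
  induction past generalizing s with
  | nil => simp_all [shockProb]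
  | cons σ p ih => exact mul_pos (ih (by rwa [List.getLastD_cons] at h)) (hM.trans_pos σ s)

theorem shockProb_eq_zero {s₀ : S} {past : List S} {s : S}
    (h : past.getLastD s ≠ s₀) : M.shockProb s₀ past s = 0 := by
  induction past generalizing s with
  | nil => simp_all [shockProb]
  | cons σ p ih => rw [shockProb, ih (by rwa [List.getLastD_cons] at h), zero_mul]

theorem shockProb_nonneg [Fintype S] (hM : M.StandingAssumption) (s₀ : S) (past : List S) (s : S) :
    0 ≤ M.shockProb s₀ past s := by
  by_cases h : past.getLastD s = s₀
  · exact (shockProb_pos hM h).le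
  · exact (shockProb_eq_zero h).ge

end Shocks

/-! ### Plans that agree after a given initial shock are indistinguishable there. -/

section Congruence

variable {M : DynamicProblem X A S ι} {x₀ : X} {σ₀ : S} {a b : ActionPlan S A}

theorem realized_congr (hab : ∀ past s, past.getLastD s = σ₀ → a past s = b past s)
    {past : List S} {s : S} (h : past.getLastD s = σ₀) : a.realized past = b.realized past := by
  induction past generalizing s with
  | nil => rfl
  | cons σ p ih =>
    have h' : p.getLastD σ = σ₀ := by rwa [List.getLastD_cons] at h
    rw [ActionPlan.realized, ActionPlan.realized, ih h', hab p σ h']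

theorem state_congr (hab : ∀ past s, past.getLastD s = σ₀ → a past s = b past s)
    {past : List S} {s : S} (h : past.getLastD s = σ₀) : M.state x₀ a past = M.state x₀ b past := by
  induction past generalizing s with
  | nil => rfl
  | cons σ p ih =>
    have h' : p.getLastD σ = σ₀ := by rwa [List.getLastD_cons] at h
    rw [state, state, ih h', hab p σ h']

open Classical in
/-- The plan that follows `a` if the initial shock is `s₀` and `b` otherwise. -/
noncomputable def splice (s₀ : S) (a b : ActionPlan S A) : ActionPlan S A := fun past s =>
  if past.getLastD s = s₀ then a past s else b past s

theorem splice_eq_left (s₀ : S) (a b : ActionPlan S A) (past : List S) (s : S)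
    (h : past.getLastD s = s₀) : splice s₀ a b past s = a past s := if_pos h

theorem splice_eq_right {s₀ σ : S} (hσ : σ ≠ s₀) (a b : ActionPlan S A) (past : List S) (s : S)
    (h : past.getLastD s = σ) : splice s₀ a b past s = b past s := if_neg (h ▸ hσ)

theorem splice_mem_feasiblePlans {s₀ : S} (ha : a ∈ M.feasiblePlans x₀)
    (hb : b ∈ M.feasiblePlans x₀) : splice s₀ a b ∈ M.feasiblePlans x₀ := by
  intro past s
  by_cases h : past.getLastD s = s₀
  · rw [state_congr (splice_eq_left s₀ a b) h, splice_eq_left s₀ a b past s h]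
    exact ha past s
  · rw [state_congr (splice_eq_right h a b) rfl, splice_eq_right h a b past s rfl]
    exact hb past s

variable [Fintype S]

theorem expect_congr {φ ψ : List S → S → ℝ}
    (hφ : ∀ past s, past.getLastD s = σ₀ → φ past s = ψ past s)
    (n : ℕ) {past : List S} {s : S} (h : past.getLastD s = σ₀) :
    M.expect n φ past s = M.expect n ψ past s := by
  induction n generalizing past s with
  | zero => exact hφ past s h
  | succ n ih =>
    exact Finset.sum_congr rfl fun s' _ => by rw [ih (List.getLastD_cons.trans h)]

theorem slack_congr (hab : ∀ past s, past.getLastD s = σ₀ → a past s = b past s) (i : ι)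
    {past : List S} {s : S} (h : past.getLastD s = σ₀) :
    M.slack x₀ a i past s = M.slack x₀ b i past s := by
  unfold slack continuation
  rw [state_congr hab h, hab past s h]
  congr 1
  refine tsum_congr fun n => ?_
  rw [expect_congr (fun q σ hq => ?_) n h]
  rw [state_congr hab hq, hab q σ hq]

theorem payoff_congr [Fintype ι] (hab : ∀ past s, past.getLastD s = σ₀ → a past s = b past s)
    (γ : ι → ℝ) : M.payoff γ x₀ σ₀ a = M.payoff γ x₀ σ₀ b := by
  refine tsum_congr fun n => ?_
  rw [expect_congr (fun q σ hq => ?_) n (by simp : ([] : List S).getLastD σ₀ = σ₀)]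
  simp only [periodPayoff, state_congr hab hq, hab q σ hq]

end Congruence

end DynamicProblem

namespace DynamicProblem

variable {X A S ι : Type*} {M : DynamicProblem X A S ι} {x₀ : X}

theorem map_fst_realized (a : ActionPlan S A) (past : List S) :
    (a.realized past).map Prod.fst = past := by
  induction past with
  | nil => rfl
  | cons s p ih => rw [ActionPlan.realized, List.map_cons, ih]

/-! ### Compactness of the plan space, continuity and uniform bounds. -/

section Continuity

variable [TopologicalSpace A] [DiscreteTopology A]

theorem isLocallyConstant_action (past : List S) (s : S) :
    IsLocallyConstant fun a : ActionPlan S A => a past s :=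
  (IsLocallyConstant.iff_continuous _).2 ((continuous_apply s).comp (continuous_apply past))

theorem isLocallyConstant_realized (past : List S) :
    IsLocallyConstant fun a : ActionPlan S A => a.realized past := by
  induction past with
  | nil => exact IsLocallyConstant.const _
  | cons s p ih => exact (isLocallyConstant_action p s).comp₂ ih fun x l => (s, x) :: l

theorem isLocallyConstant_state (past : List S) :
    IsLocallyConstant fun a : ActionPlan S A => M.state x₀ a past := by
  induction past with
  | nil => exact IsLocallyConstant.const _
  | cons s p ih => exact ih.comp₂ (isLocallyConstant_action p s) fun y x => M.ζ y x s

theorem isLocallyConstant_period (F : X → A → S → ℝ) (past : List S) (s : S) :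
    IsLocallyConstant fun a : ActionPlan S A => F (M.state x₀ a past) (a past s) s :=
  (isLocallyConstant_state past).comp₂ (isLocallyConstant_action past s) fun y x => F y x s

theorem isCompact_feasiblePlans [Finite A] : IsCompact (M.feasiblePlans x₀) := by
  have h : M.feasiblePlans x₀ = ⋂ (past : List S) (s : S),
      {a | 0 ≤ M.p (M.state x₀ a past) (a past s) s} := by
    ext a
    simp [feasiblePlans]
  rw [h]
  exact (isClosed_iInter fun past => isClosed_iInter fun s =>
    isClosed_le continuous_const (isLocallyConstant_period M.p past s).continuous).isCompact

theorem continuous_periodPayoff [Fintype ι] (γ : ι → ℝ) (past : List S) (s : S) :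
    Continuous fun a : ActionPlan S A => M.periodPayoff γ x₀ a past s :=
  (isLocallyConstant_period (fun y x σ => M.r y x σ + ∑ i, γ i * M.g i y x σ) past s).continuous

variable [Fintype S]

theorem continuous_slack (hM : M.StandingAssumption) (i : ι) (past : List S) (s : S) :
    Continuous fun a : ActionPlan S A => M.slack x₀ a i past s := by
  obtain ⟨C, hC⟩ := hM.bounded_g i
  exact (continuous_tsum_discounted_expect hM
    (fun q σ => (isLocallyConstant_period (M.g i) q σ).continuous)
    (fun a q σ => hC _ _ _) past s).sub (isLocallyConstant_period (M.gbar i) past s).continuous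

end Continuity

section Bounds

variable [Fintype S]

theorem exists_abs_slack_le (hM : M.StandingAssumption) (i : ι) :
    ∃ C, ∀ (a : ActionPlan S A) past s, |M.slack x₀ a i past s| ≤ C := by
  obtain ⟨C, hC⟩ := hM.bounded_g i
  obtain ⟨B, hB⟩ := hM.bounded_gbar i
  refine ⟨∑' n : ℕ, M.β ^ n * C + B, fun a past s => ?_⟩
  refine (abs_sub _ _).trans (add_le_add ?_ (hB _ _ _))
  exact tsum_of_norm_bounded (summable_discount_mul hM C).hasSum fun n =>
    norm_discounted_expect_le hM (fun q σ => hC _ _ _) n past s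

theorem exists_abs_periodPayoff_le [Fintype ι] (hM : M.StandingAssumption) (γ : ι → ℝ) :
    ∃ C, ∀ (a : ActionPlan S A) past s, |M.periodPayoff γ x₀ a past s| ≤ C := by
  obtain ⟨R, hR⟩ := hM.bounded_r
  choose G hG using hM.bounded_g
  refine ⟨R + ∑ i, |γ i| * G i, fun a past s => ?_⟩
  refine (abs_add_le _ _).trans (add_le_add (hR _ _ _) ?_)
  refine (Finset.abs_sum_le_sum_abs _ _).trans (Finset.sum_le_sum fun i _ => ?_)
  rw [abs_mul]
  exact mul_le_mul_of_nonneg_left (hG i _ _ _) (abs_nonneg _)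

end Bounds

theorem continuous_payoff [TopologicalSpace A] [DiscreteTopology A] [Fintype S] [Fintype ι]
    (hM : M.StandingAssumption) (γ : ι → ℝ) (s₀ : S) :
    Continuous fun a : ActionPlan S A => M.payoff γ x₀ s₀ a := by
  obtain ⟨C, hC⟩ := exists_abs_periodPayoff_le (x₀ := x₀) hM γ
  exact continuous_tsum_discounted_expect hM (continuous_periodPayoff γ) hC [] s₀

variable [Fintype S]

/-- The slack of the `i`-th constraint at the pre-action history `h`, on the event that the plan
generates `h`. -/
noncomputable def localSlack (M : DynamicProblem X A S ι) (x₀ : X) (j : ι × PreHistory S A)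
    (a : ActionPlan S A) : ℝ :=
  Set.indicator {b : ActionPlan S A | b.realized (j.2.1.map Prod.fst) = j.2.1}
    (fun b => M.slack x₀ b j.1 (j.2.1.map Prod.fst) j.2.2) a

/-- The event of generating a given history depends on finitely many discrete coordinates, so it is
clopen and its indicator preserves continuity. -/
theorem continuous_localSlack [TopologicalSpace A] [DiscreteTopology A]
    (hM : M.StandingAssumption) (j : ι × PreHistory S A) : Continuous (M.localSlack x₀ j) := by
  have h : IsClopen {b : ActionPlan S A | b.realized (j.2.1.map Prod.fst) = j.2.1} :=
    (isLocallyConstant_realized (j.2.1.map Prod.fst)).isClopen_fiber j.2.1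
  exact (continuous_slack hM j.1 _ _).indicator (by simp [h.frontier_eq])

theorem exists_abs_localSlack_le [Finite ι] (hM : M.StandingAssumption) :
    ∃ C, ∀ j (a : ActionPlan S A), |M.localSlack x₀ j a| ≤ C := by
  cases nonempty_fintype ι
  choose C hC using fun i => exists_abs_slack_le (x₀ := x₀) hM i
  refine ⟨∑ i, |C i|, fun j a => ?_⟩
  have h1 : |M.slack x₀ a j.1 (j.2.1.map Prod.fst) j.2.2| ≤ ∑ i, |C i| :=
    (hC _ _ _ _).trans ((le_abs_self _).trans
      (Finset.single_le_sum (f := fun i => |C i|) (fun i _ => abs_nonneg _) (Finset.mem_univ j.1)))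
  exact (norm_indicator_le_norm_self (fun b => M.slack x₀ b j.1 (j.2.1.map Prod.fst) j.2.2)
    a).trans h1

theorem localSlack_congr {σ₀ : S} {a b : ActionPlan S A}
    (hab : ∀ past s, past.getLastD s = σ₀ → a past s = b past s) {j : ι × PreHistory S A}
    (hj : (j.2.1.map Prod.fst).getLastD j.2.2 = σ₀) : M.localSlack x₀ j a = M.localSlack x₀ j b := by
  classical
  simp only [localSlack, Set.indicator_apply, Set.mem_ofPred_eq, realized_congr hab hj,
    slack_congr hab j.1 hj]

theorem localSlack_nonneg {a : ActionPlan S A} (ha : M.IsFeasible x₀ a) (j : ι × PreHistory S A) :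
    0 ≤ M.localSlack x₀ j a :=
  Set.indicator_apply_nonneg fun _ => ha.2 _ _ _

/-- The weight of a multiplier in the Lagrangian. -/
noncomputable def multiplierWeight (M : DynamicProblem X A S ι) (s₀ : S)
    (lam : ι → PreHistory S A → ℝ) (j : ι × PreHistory S A) : ℝ :=
  M.β ^ j.2.1.length * lam j.1 j.2 * M.shockProb s₀ (j.2.1.map Prod.fst) j.2.2

theorem multiplierWeight_nonneg (hM : M.StandingAssumption) {s₀ : S}
    {lam : ι → PreHistory S A → ℝ} (hlam : lam ∈ M.multipliers s₀) (j : ι × PreHistory S A) :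
    0 ≤ M.multiplierWeight s₀ lam j :=
  mul_nonneg (mul_nonneg (pow_nonneg hM.β_pos.le _) (hlam.1 _ _)) (shockProb_nonneg hM _ _ _)

theorem summable_multiplierWeight_mul_localSlack [Finite ι] (hM : M.StandingAssumption)
    {s₀ : S} {lam : ι → PreHistory S A → ℝ} (hlam : lam ∈ M.multipliers s₀) (a : ActionPlan S A) :
    Summable fun j => M.multiplierWeight s₀ lam j * M.localSlack x₀ j a := by
  obtain ⟨C, hC⟩ := exists_abs_localSlack_le (x₀ := x₀) hM
  refine Summable.of_norm_bounded (hlam.2.mul_right C) fun j => ?_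
  rw [norm_mul, Real.norm_of_nonneg (multiplierWeight_nonneg hM hlam j)]
  exact mul_le_mul_of_nonneg_left (hC j a) (multiplierWeight_nonneg hM hlam j)

/-- Along each shock history a plan generates exactly one pre-action history, and `localSlack`
vanishes at all others. The sum over pre-action histories thus collapses to one over shock
histories. -/
theorem hasSum_shockHistories (hM : M.StandingAssumption) [Fintype ι]
    {s₀ : S} {lam : ι → PreHistory S A → ℝ} (hlam : lam ∈ M.multipliers s₀) (a : ActionPlan S A) :
    HasSum (fun q : List S × S => M.β ^ q.1.length * (M.shockProb s₀ q.1 q.2 *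
        ∑ i, lam i (a.realized q.1, q.2) * M.slack x₀ a i q.1 q.2))
      (∑' j, M.multiplierWeight s₀ lam j * M.localSlack x₀ j a) := by
  have hsum := summable_multiplierWeight_mul_localSlack (x₀ := x₀) hM hlam a
  let e : List S × S → PreHistory S A := fun q => (a.realized q.1, q.2)
  have he : Function.Injective e := by
    rintro ⟨p, s⟩ ⟨p', s'⟩ h
    obtain ⟨h1, h2⟩ := Prod.mk.inj h
    have := congrArg (List.map Prod.fst) h1
    rw [map_fst_realized, map_fst_realized] at this
    exact Prod.ext this h2
  rw [hsum.tsum_prod, tsum_fintype]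
  have hi : ∀ i ∈ (Finset.univ : Finset ι), HasSum
      (fun q => M.multiplierWeight s₀ lam (i, e q) * M.localSlack x₀ (i, e q) a)
      (∑' h, M.multiplierWeight s₀ lam (i, h) * M.localSlack x₀ (i, h) a) := by
    intro i _
    refine (he.hasSum_iff fun h hh => ?_).2 (hsum.prod_factor i).hasSum
    have : M.localSlack x₀ (i, h) a = 0 := by
      rw [localSlack, Set.indicator_of_notMem]
      exact fun hmem => hh ⟨(h.1.map Prod.fst, h.2), Prod.ext hmem rfl⟩
    rw [this, mul_zero]
  refine (hasSum_sum hi).congr_fun fun q => ?_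
  rw [Finset.mul_sum, Finset.mul_sum]
  refine Finset.sum_congr rfl fun i _ => ?_
  have h1 : M.localSlack x₀ (i, e q) a = M.slack x₀ a i q.1 q.2 := by
    rw [localSlack, Set.indicator_of_mem] <;> simp [e, map_fst_realized]
  have h2 : (a.realized q.1).length = q.1.length := by
    rw [← List.length_map (f := Prod.fst), map_fst_realized]
  rw [h1]
  simp only [multiplierWeight, e, map_fst_realized, h2]
  ring

/-- The Lagrangian as a sum over pre-action histories. -/
theorem lagrangian_eq (hM : M.StandingAssumption) [Fintype ι] (γ : ι → ℝ)
    {s₀ : S} {lam : ι → PreHistory S A → ℝ} (hlam : lam ∈ M.multipliers s₀) (a : ActionPlan S A) :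
    M.lagrangian γ x₀ s₀ a lam
      = M.payoff γ x₀ s₀ a + ∑' j, M.multiplierWeight s₀ lam j * M.localSlack x₀ j a := by
  obtain ⟨C, hC⟩ := exists_abs_periodPayoff_le (x₀ := x₀) hM γ
  have h1 : Summable fun t : ℕ => M.β ^ t * M.expect t (M.periodPayoff γ x₀ a) [] s₀ :=
    Summable.of_norm_bounded (summable_discount_mul hM C) fun n =>
      norm_discounted_expect_le hM (hC a) n [] s₀
  have h2 := hasSum_sum_histories (hasSum_shockHistories (x₀ := x₀) hM hlam a)
  refine (h1.hasSum.add h2).tsum_eq ▸ tsum_congr fun t => ?_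
  rw [expect_add, mul_add, expect_eq_sum_histories s₀
    (fun past s => ∑ i, lam i (a.realized past, s) * M.slack x₀ a i past s), Finset.mul_sum]
  congr 1
  exact Finset.sum_congr rfl fun q hq => by rw [mem_histories.1 hq]

end DynamicProblem

/-! ### The two duality inequalities. -/

namespace DynamicProblem

variable {X A S ι : Type*} [Fintype S] {M : DynamicProblem X A S ι} {x₀ : X}

theorem mem_feasibleLotteries_iff [MeasurableSpace A] {P : M.Lottery x₀} :
    P ∈ M.feasibleLotteries x₀ ↔
      ∀ j, 0 ≤ ∫ a, M.localSlack x₀ j (a : ActionPlan S A) ∂(P : Measure (M.feasiblePlans x₀)) := by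
  classical
  simp only [feasibleLotteries, localSlack, Set.indicator_apply, Set.mem_ofPred_eq, Prod.forall]

variable [Fintype ι]

/-- Any bound obtained from finitely supported multipliers on all constraints bounds the dual
value. -/
theorem dualValue_le_of_finsupp (hM : M.StandingAssumption) (γ : ι → ℝ) (s₀ : S)
    {m : ι × PreHistory S A →₀ ℝ} (hm : ∀ j, 0 ≤ m j) {v : ℝ}
    (hv : ∀ a ∈ M.feasiblePlans x₀,
      M.payoff γ x₀ s₀ a + ∑ j ∈ m.support, m j * M.localSlack x₀ j a ≤ v) :
    M.dualValue γ x₀ s₀ ≤ v := by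
  let w : ι × PreHistory S A → ℝ := fun j =>
    M.β ^ j.2.1.length * M.shockProb s₀ (j.2.1.map Prod.fst) j.2.2
  have hw : ∀ j, 0 ≤ w j := fun j =>
    mul_nonneg (pow_nonneg hM.β_pos.le _) (shockProb_nonneg hM _ _ _)
  -- Where `w` vanishes, division by zero gives 0, so the multiplier is lost there; hence the factor
  -- `w j / w j` below, equal to 1 or 0.
  let lam : ι → PreHistory S A → ℝ := fun i h => m (i, h) / w (i, h)
  have hweight : ∀ j, M.multiplierWeight s₀ lam j = m j * (w j / w j) := fun j => by
    simp only [multiplierWeight, lam, w]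
    ring
  have hsupp : ∀ j ∉ m.support, M.multiplierWeight s₀ lam j = 0 := fun j hj => by
    rw [hweight, Finsupp.notMem_support_iff.1 hj, zero_mul]
  have hlam : lam ∈ M.multipliers s₀ :=
    ⟨fun i h => div_nonneg (hm _) (hw _), summable_of_ne_finset_zero (s := m.support) hsupp⟩
  refine (iInf₂_le lam hlam).trans (iSup₂_le fun a ha => ?_)
  obtain ⟨b, hb⟩ := hM.exists_feasible x₀
  refine EReal.coe_le_coe_iff.2 ?_
  rw [lagrangian_eq hM γ hlam, tsum_eq_sum (s := m.support)
    fun j hj => by rw [hsupp j hj, zero_mul]]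
  -- The bound is used at the spliced plan rather than at `a`. It has the same payoff and the same
  -- slacks after `s₀`, while after other initial shocks it follows the feasible `b`, so the lost
  -- terms of the bound are nonnegative.
  refine le_trans ?_ (hv _ (splice_mem_feasiblePlans (s₀ := s₀) ha hb.1))
  rw [payoff_congr (splice_eq_left s₀ a b)]
  refine add_le_add_right (Finset.sum_le_sum fun j _ => ?_) _
  rw [hweight]
  by_cases h : (j.2.1.map Prod.fst).getLastD j.2.2 = s₀
  · have hpos : 0 < w j := mul_pos (pow_pos hM.β_pos _) (shockProb_pos hM h)
    rw [div_self hpos.ne', mul_one, localSlack_congr (splice_eq_left s₀ a b) h]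
  · have h0 : w j = 0 := by simp only [w, shockProb_eq_zero h, mul_zero]
    rw [h0, div_zero, mul_zero, zero_mul, localSlack_congr (splice_eq_right h a b) rfl]
    exact mul_nonneg (hm j) (localSlack_nonneg hb j)

variable [Finite A] [MeasurableSpace A] [DiscreteMeasurableSpace A]

/-- Weak duality. -/
theorem lotteryValue_le_dualValue [TopologicalSpace A] [DiscreteTopology A]
    (hM : M.StandingAssumption) (γ : ι → ℝ) (s₀ : S) :
    M.lotteryValue γ x₀ s₀ ≤ M.dualValue γ x₀ s₀ := by
  have : CompactSpace (M.feasiblePlans x₀) := isCompact_iff_compactSpace.1 isCompact_feasiblePlans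
  refine iSup₂_le fun P hP => le_iInf₂ fun lam hlam => ?_
  rw [mem_feasibleLotteries_iff] at hP
  obtain ⟨C, hC⟩ := exists_abs_localSlack_le (x₀ := x₀) hM
  let T : ι × PreHistory S A → M.feasiblePlans x₀ → ℝ := fun j a =>
    M.multiplierWeight s₀ lam j * M.localSlack x₀ j (a : ActionPlan S A)
  have hT : ∀ j, Continuous (T j) := fun j =>
    continuous_const.mul ((continuous_localSlack hM j).comp continuous_subtype_val)
  have hTC : ∀ j a, ‖T j a‖ ≤ M.multiplierWeight s₀ lam j * C := fun j a => by
    rw [norm_mul, Real.norm_of_nonneg (multiplierWeight_nonneg hM hlam j)]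
    exact mul_le_mul_of_nonneg_left (hC j a) (multiplierWeight_nonneg hM hlam j)
  have hTsum : Continuous fun a => ∑' j, T j a := continuous_tsum hT (hlam.2.mul_right C) hTC
  have hF : Continuous fun a : M.feasiblePlans x₀ => M.payoff γ x₀ s₀ (a : ActionPlan S A) :=
    (continuous_payoff hM γ s₀).comp continuous_subtype_val
  have hint : ∀ {φ : M.feasiblePlans x₀ → ℝ}, Continuous φ →
      Integrable φ (P : Measure (M.feasiblePlans x₀)) :=
    fun hφ => integrable_of_continuous_of_compactSpace hφ _
  have hTint : 0 ≤ ∫ a, ∑' j, T j a ∂(P : Measure (M.feasiblePlans x₀)) := by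
    refine (hasSum_integral_of_dominated_convergence
      (fun j _ => M.multiplierWeight s₀ lam j * C) (fun j => (hint (hT j)).aestronglyMeasurable)
      (fun j => Filter.Eventually.of_forall (hTC j))
      (Filter.Eventually.of_forall fun _ => hlam.2.mul_right C) (integrable_const _)
      (Filter.Eventually.of_forall fun a =>
        (Summable.of_norm_bounded (hlam.2.mul_right C) fun j => hTC j a).hasSum)).nonneg fun j => ?_
    simp only [T, integral_const_mul]
    exact mul_nonneg (multiplierWeight_nonneg hM hlam j) (hP j)
  -- Some plan does at least as well as the average Lagrangian.
  obtain ⟨a, ha⟩ := exists_integral_le (hint (hF.add hTsum))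
  rw [integral_add' (hint hF) (hint hTsum)] at ha
  refine le_trans (EReal.coe_le_coe_iff.2 ?_) (le_iSup₂
    (f := fun a (_ : a ∈ M.feasiblePlans x₀) => (M.lagrangian γ x₀ s₀ a lam : EReal)) a.1 a.2)
  rw [lagrangian_eq hM γ hlam]
  exact (le_add_of_nonneg_right hTint).trans ha

end DynamicProblem

theorem mainTheorem1 {X A S ι : Type*} [Countable X] [Finite A] [MeasurableSpace A]
    [DiscreteMeasurableSpace A] [Fintype S] [Fintype ι]
    (M : DynamicProblem X A S ι) (hM : M.StandingAssumption)
    (γ : ι → ℝ) (hγ : ∀ i, 0 ≤ γ i) (x₀ : X) (s₀ : S) :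
    (∃ P ∈ M.feasibleLotteries x₀,
        (M.lotteryPayoff γ x₀ s₀ P : EReal) = M.lotteryValue γ x₀ s₀) ∧
      M.lotteryValue γ x₀ s₀ = M.dualValue γ x₀ s₀ := by
  -- With the discrete topology on the finite set `A` and countably many shock histories, the
  -- product σ-algebra on plans is the Borel one.
  let _ : TopologicalSpace A := ⊥
  have _ : DiscreteTopology A := ⟨rfl⟩
  have : CompactSpace (M.feasiblePlans x₀) :=
    isCompact_iff_compactSpace.1 DynamicProblem.isCompact_feasiblePlans
  have hc : ∀ j, Continuous fun a : M.feasiblePlans x₀ =>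
      M.localSlack x₀ j (a : ActionPlan S A) := fun j =>
    (DynamicProblem.continuous_localSlack hM j).comp continuous_subtype_val
  have hF : Continuous fun a : M.feasiblePlans x₀ => M.payoff γ x₀ s₀ (a : ActionPlan S A) :=
    (DynamicProblem.continuous_payoff hM γ s₀).comp continuous_subtype_val
  obtain ⟨b, hb⟩ := hM.exists_feasible x₀
  have hcomp : IsCompact (M.feasibleLotteries x₀) := by
    have h : M.feasibleLotteries x₀ = ⋂ j, {P : M.Lottery x₀ |
        0 ≤ ∫ a, M.localSlack x₀ j (a : ActionPlan S A) ∂(P : Measure (M.feasiblePlans x₀))} := by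
      ext P
      rw [DynamicProblem.mem_feasibleLotteries_iff, Set.mem_iInter]
      rfl
    rw [h]
    exact (isClosed_iInter fun j => isClosed_le continuous_const
      (continuous_integral_probabilityMeasure (hc j))).isCompact
  have hne : (M.feasibleLotteries x₀).Nonempty := by
    refine ⟨⟨Measure.dirac ⟨b, hb.1⟩, inferInstance⟩,
      DynamicProblem.mem_feasibleLotteries_iff.2 fun j => ?_⟩
    rw [ProbabilityMeasure.coe_mk, integral_dirac' _ _ (hc j).stronglyMeasurable]
    exact DynamicProblem.localSlack_nonneg hb j
  obtain ⟨P, hP, hmax⟩ := hcomp.exists_isMaxOn hne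
    (continuous_integral_probabilityMeasure hF).continuousOn
  have hval : (M.lotteryPayoff γ x₀ s₀ P : EReal) = M.lotteryValue γ x₀ s₀ :=
    le_antisymm (le_iSup₂ (f := fun P _ => (M.lotteryPayoff γ x₀ s₀ P : EReal)) P hP)
      (iSup₂_le fun Q hQ => EReal.coe_le_coe_iff.2 (hmax hQ))
  refine ⟨⟨P, hP, hval⟩, (DynamicProblem.lotteryValue_le_dualValue hM γ s₀).antisymm ?_⟩
  rw [← hval]
  -- It suffices to bound the dual value by each real `v` above the maximum; the dual infimum itself
  -- need not be attained.
  refine EReal.le_of_forall_lt_iff_le.1 fun v hv => ?_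
  obtain ⟨m, hm, hmv⟩ := exists_finsupp_multipliers hF hc ⟨b, hb.1⟩
    (DynamicProblem.localSlack_nonneg hb) (v := v) fun Q hQ =>
      (hmax (DynamicProblem.mem_feasibleLotteries_iff.2 hQ)).trans_lt (EReal.coe_lt_coe_iff.1 hv)
  exact DynamicProblem.dualValue_le_of_finsupp hM γ s₀ hm fun a ha => (hmv ⟨a, ha⟩).le
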